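/- A represented space is a set $X$ with a partial surjection $\delta_X:\subseteq\mathbb N^{\mathbb N}\to X$; the elements of $\delta_X^{-1}(x)$ are the names of $x$. A realizer of a partial multivalued function $f:\subseteq X\rightrightarrows Y$ between represented spaces is a partial function $F:\subseteq\mathbb N^{\mathbb N}\to\mathbb N^{\mathbb N}$ such that, whenever $p$ is a name of some $x\in\operatorname{dom}(f)$, $F(p)$ is defined and is a name of some element of $f(x)$. Write $f\le_{\mathrm W}g$ if there are computable partial functions $K,H:\subseteq\mathbb N^{\mathbb N}\to\mathbb N^{\mathbb N}$ such that $p\mapsto K\langle p,G(H(p))\rangle$ is a realizer of $f$ for every realizer $G$ of $g$, and $f\equiv_{\mathrm W}g$ if $f\le_{\mathrm W}g$ and $g\le_{\mathrm W}f$. Let $\mathbf{Tr}$ be the space of trees on $\mathbb N$ (sets of finite sequences of natural numbers closed under initial segments), represented by their characteristic functions; for $T\in\mathbf{Tr}$ let $[T]\subseteq\mathbb N^{\mathbb N}$ be its set of infinite paths. A tree is perfect if it is nonempty and each of its nodes has two incomparable extensions in the tree. Let $\mathcal A(\mathbb N^{\mathbb N})$ be the space of closed subsets of $\mathbb N^{\mathbb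 N}$ with negative information: a name of $A$ is a name of the characteristic function of the open set $\mathbb N^{\mathbb N}\setminus A$ as a continuous function from $\mathbb N^{\mathbb N}$ to Sierpiński space $\{\top,\bot\}$, where $0^\omega$ is the only name of $\bot$ and every other sequence is a name of $\top$. The one-sided perfect tree theorem $\mathsf{PTT}_1:\subseteq\mathbf{Tr}\rightrightarrows\mathbf{Tr}$ has as domain the trees $T$ for which $[T]$ is uncountable and maps such a $T$ to all perfect trees $T'\subseteq T$. Closed choice $\mathsf C_{\mathbb N^{\mathbb N}}:\subseteq\mathcal A(\mathbb N^{\mathbb N})\rightrightarrows\mathbb N^{\mathbb N}$ has as domain the nonempty closed sets and maps such a set $A$ to all its elements. **Proposition.** $\mathsf{PTT}_1\equiv_{\mathrm W}\mathsf C_{\mathbb N^{\mathbb N}}$. -/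

import Mathlib

/-! Represented spaces, computability on Baire space, Weihrauch reducibility, closed choice and
the one-sided perfect tree theorem. -/

namespace Weihrauch

/-! ### Baire space and computable partial functions on it -/

/-- Baire space `ℕ^ℕ`, with its product topology. -/
abbrev Baire : Type := ℕ → ℕ

/-- The initial segment of length `n` of `p`. -/
def initSeg (p : Baire) (n : ℕ) : List ℕ := (List.range n).map p

/-- In the limit, the word function `φ` outputs `y` on input `p`: every word `φ (p ↾ n)` is an
initial segment of `y`, and these words get arbitrarily long. -/
def Produces (φ : List ℕ → List ℕ) (p y : Baire) : Prop :=
  (∀ n, φ (initSeg p n) = initSeg y (φ (initSeg p n)).length) ∧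
    ∀ k, ∃ n, k ≤ (φ (initSeg p n)).length

theorem initSeg_length (p : Baire) (n : ℕ) : (initSeg p n).length = n := by
  simp [initSeg]

theorem initSeg_eq_iff (p q : Baire) (n : ℕ) :
    initSeg p n = initSeg q n ↔ ∀ i < n, p i = q i := by
  simp [initSeg]

theorem Produces.unique {φ : List ℕ → List ℕ} {p y z : Baire}
    (hy : Produces φ p y) (hz : Produces φ p z) : y = z := by
  funext i
  obtain ⟨n, hn⟩ := hy.2 (i + 1)
  exact (initSeg_eq_iff y z _).1 ((hy.1 n).symm.trans (hz.1 n)) i hn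

/-- The partial function on Baire space given by the word function `φ`; it is defined at `p`
exactly when the words `φ (p ↾ n)` converge to an infinite sequence. -/
noncomputable def limitFun (φ : List ℕ → List ℕ) : Baire →. Baire :=
  fun p => ⟨∃ y, Produces φ p y, fun h => h.choose⟩

theorem mem_limitFun {φ : List ℕ → List ℕ} {p y : Baire} :
    y ∈ limitFun φ p ↔ Produces φ p y := by
  constructor
  · rintro ⟨h, rfl⟩
    exact h.choose_spec
  · intro h
    exact ⟨⟨y, h⟩, Produces.unique (Exists.choose_spec (⟨y, h⟩ : ∃ y, Produces φ p y)) h⟩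

/-- `F` is computable: some (Turing-)computable word function produces `F p` in the limit from
the initial segments of `p`, for every `p` in the domain of `F`. -/
def IsComputable (F : Baire →. Baire) : Prop :=
  ∃ φ : List ℕ → List ℕ, Computable φ ∧ ∀ p, ∀ y ∈ F p, y ∈ limitFun φ p

/-- `F` is continuous on its domain (with the subspace topology). -/
def IsContinuous (F : Baire →. Baire) : Prop :=
  Continuous fun p : F.Dom => F.fn p.1 p.2

/-- The word function coded by `q`. -/
def wordFun (q : Baire) : List ℕ → List ℕ :=
  fun w => Denumerable.ofNat (List ℕ) (q (Encodable.encode w))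

theorem exists_wordFun (φ : List ℕ → List ℕ) : ∃ q, wordFun q = φ := by
  refine ⟨fun n => Encodable.encode (φ (Denumerable.ofNat (List ℕ) n)), ?_⟩
  funext w
  simp [wordFun]

/-- The pairing `⟨p, q⟩ = p 0, q 0, p 1, q 1, …` on Baire space. -/
def pair (p q : Baire) : Baire := fun n => if n % 2 = 0 then p (n / 2) else q (n / 2)

/-- Every continuous partial function is a restriction of one that is given by a word function. -/
theorem exists_code_of_isContinuous {F : Baire →. Baire} (hF : IsContinuous F) :
    ∃ q, ∀ p, ∀ y ∈ F p, y ∈ limitFun (wordFun q) p := by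
  classical
  let P : List ℕ → ℕ → Prop := fun w k => ∀ p p' y y' : Baire,
    initSeg p w.length = w → initSeg p' w.length = w → y ∈ F p → y' ∈ F p' →
      initSeg y k = initSeg y' k
  let φ : List ℕ → List ℕ := fun w =>
    if h : ∃ y p, initSeg p w.length = w ∧ y ∈ F p then
      initSeg h.choose (Nat.findGreatest (P w) w.length) else []
  have hφ : ∀ p, ∀ y ∈ F p, ∀ n,
      φ (initSeg p n) = initSeg y (Nat.findGreatest (P (initSeg p n)) n) := by
    intro p y hy n
    have hp : initSeg p (initSeg p n).length = initSeg p n := by rw [initSeg_length]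
    have h : ∃ y p', initSeg p' (initSeg p n).length = initSeg p n ∧ y ∈ F p' := ⟨y, p, hp, hy⟩
    have hP : P (initSeg p n) (Nat.findGreatest (P (initSeg p n)) n) :=
      Nat.findGreatest_spec (Nat.zero_le n) (fun _ _ _ _ _ _ _ _ => by simp [initSeg])
    obtain ⟨p', hp', hy'⟩ := h.choose_spec
    simp only [φ, dif_pos h]
    exact (congrArg (fun m => initSeg h.choose (Nat.findGreatest (P (initSeg p n)) m))
      (initSeg_length p n)).trans (hP _ _ _ _ hp' hp hy' hy)
  obtain ⟨q, hq⟩ := exists_wordFun φ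
  refine ⟨q, fun p y hy => mem_limitFun.2 ?_⟩
  rw [hq]
  refine ⟨fun n => ?_, fun k => ?_⟩
  · rw [hφ p y hy n, initSeg_length]
  · obtain ⟨hd, rfl⟩ := hy
    have hU : IsOpen ((fun p : F.Dom => F.fn p.1 p.2) ⁻¹' PiNat.cylinder (F.fn p hd) k) :=
      (PiNat.isOpen_cylinder (fun _ => ℕ) _ k).preimage hF
    obtain ⟨V, hV, hVU⟩ := isOpen_induced_iff.1 hU
    have hpV : p ∈ V := by
      have : (⟨p, hd⟩ : F.Dom) ∈ Subtype.val ⁻¹' V := by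
        rw [hVU]
        exact PiNat.self_mem_cylinder _ _
      exact this
    obtain ⟨s, ⟨x, n, rfl⟩, hps, hsV⟩ :=
      (PiNat.isTopologicalBasis_cylinders (fun _ => ℕ)).exists_subset_of_mem_open hpV hV
    have key : ∀ p' y', initSeg p' (max n k) = initSeg p (max n k) → y' ∈ F p' →
        initSeg y' k = initSeg (F.fn p hd) k := by
      rintro p' _ hp' ⟨hd', rfl⟩
      have hp'V : p' ∈ V := by
        refine hsV fun i hi => ?_
        rw [(initSeg_eq_iff _ _ _).1 hp' i (lt_of_lt_of_le hi (le_max_left _ _))]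
        exact hps i hi
      have : (⟨p', hd'⟩ : F.Dom) ∈ Subtype.val ⁻¹' V := hp'V
      rw [hVU] at this
      exact (initSeg_eq_iff _ _ _).2 this
    refine ⟨max n k, ?_⟩
    rw [hφ p _ ⟨hd, rfl⟩, initSeg_length]
    refine Nat.le_findGreatest (le_max_right _ _) ?_
    intro p₁ p₂ y₁ y₂ h₁ h₂ hy₁ hy₂
    rw [initSeg_length] at h₁ h₂
    rw [key p₁ y₁ h₁ hy₁, key p₂ y₂ h₂ hy₂]

/-! ### Represented spaces and problems -/

/-- A represented space: a set with a partial surjection `δ` from Baire space onto it, given by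
its graph; `IsName p x` says that `δ p` is defined and equal to `x`. -/
structure RepSpace where
  carrier : Type
  IsName : Baire → carrier → Prop
  unique : ∀ {p x y}, IsName p x → IsName p y → x = y
  surjective : ∀ x, ∃ p, IsName p x

/-- A partial multivalued function between represented spaces. -/
structure MultiFun (X Y : RepSpace) where
  dom : Set X.carrier
  val : X.carrier → Set Y.carrier
  nonempty : ∀ x ∈ dom, (val x).Nonempty

/-- A total single-valued function as a multivalued function. -/
def MultiFun.ofFun {X Y : RepSpace} (f : X.carrier → Y.carrier) : MultiFun X Y where
  dom := Set.univ
  val x := {f x}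
  nonempty x _ := ⟨f x, rfl⟩

/-- `F ⊢ f`: the partial function `F` maps each name of each `x` in the domain of `f` to a name
of a value of `f` at `x`. -/
def Realizes {X Y : RepSpace} (F : Baire →. Baire) (f : MultiFun X Y) : Prop :=
  ∀ p x, X.IsName p x → x ∈ f.dom → ∃ q ∈ F p, ∃ y ∈ f.val x, Y.IsName q y

theorem Realizes.mono {X Y : RepSpace} {F G : Baire →. Baire} {f : MultiFun X Y}
    (h : ∀ p, ∀ y ∈ F p, y ∈ G p) (hF : Realizes F f) : Realizes G f := by
  intro p x hp hx
  obtain ⟨q, hq, hy⟩ := hF p x hp hx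
  exact ⟨q, h p q hq, hy⟩

/-- Weihrauch reducibility: there are computable `K`, `H` such that
`p ↦ K ⟨p, G (H p)⟩` realizes `f` whenever `G` realizes `g`. -/
def WeihrauchReducible {X Y Z W : RepSpace} (f : MultiFun X Y) (g : MultiFun Z W) : Prop :=
  ∃ K H : Baire →. Baire, IsComputable K ∧ IsComputable H ∧
    ∀ G : Baire →. Baire, Realizes G g →
      Realizes (fun p => (H p).bind fun r => (G r).bind fun s => K (pair p s)) f

/-- Weihrauch equivalence. -/
def WeihrauchEquivalent {X Y Z W : RepSpace} (f : MultiFun X Y) (g : MultiFun Z W) : Prop :=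
  WeihrauchReducible f g ∧ WeihrauchReducible g f

/-! ### Function spaces, open and closed sets, closed choice -/

/-- The represented space `C(X, Y)` of the functions with a continuous realizer. A name of `f`
is a code of a word function whose partial function realizes `f`. -/
def functionSpace (X Y : RepSpace) : RepSpace where
  carrier := {f : X.carrier → Y.carrier //
    ∃ F : Baire →. Baire, IsContinuous F ∧ Realizes F (MultiFun.ofFun f)}
  IsName q f := Realizes (limitFun (wordFun q)) (MultiFun.ofFun f.1)
  unique := by
    intro q f g hf hg
    apply Subtype.ext
    funext x
    obtain ⟨p, hp⟩ := X.surjective x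
    obtain ⟨r, hr, y, hy, hry⟩ := hf p x hp trivial
    obtain ⟨r', hr', y', hy', hry'⟩ := hg p x hp trivial
    obtain rfl := Part.mem_unique hr hr'
    have hfy : y = f.1 x := hy
    have hgy : y' = g.1 x := hy'
    rw [← hfy, ← hgy]
    exact Y.unique hry hry'
  surjective := by
    rintro ⟨f, F, hF, hFf⟩
    obtain ⟨q, hq⟩ := exists_code_of_isContinuous hF
    exact ⟨q, hFf.mono hq⟩

/-- Baire space, represented by the identity. -/
def baireSpace : RepSpace where
  carrier := Baire
  IsName p x := p = x
  unique := by
    rintro p x y rfl rfl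
    rfl
  surjective x := ⟨x, rfl⟩

/-- Sierpiński space: the truth values, the only name of `False` being `000…`. -/
def sierpinski : RepSpace where
  carrier := Prop
  IsName p b := b ↔ ∃ n, p n ≠ 0
  unique h h' := propext (h.trans h'.symm)
  surjective b := by
    by_cases hb : b
    · exact ⟨fun _ => 1, by simp [hb]⟩
    · exact ⟨fun _ => 0, by simp [hb]⟩

/-- The represented space `O(X)` of open subsets of `X`, that is, of the sets with a continuous
characteristic function into Sierpiński space; the names are those of this function. -/
def openSets (X : RepSpace) : RepSpace where
  carrier := {U : Set X.carrier // ∃ χ : (functionSpace X sierpinski).carrier,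
    ∀ x, χ.1 x ↔ x ∈ U}
  IsName q U := ∃ χ : (functionSpace X sierpinski).carrier,
    (∀ x, χ.1 x ↔ x ∈ U.1) ∧ (functionSpace X sierpinski).IsName q χ
  unique := by
    rintro q U V ⟨χ, hχ, hq⟩ ⟨χ', hχ', hq'⟩
    obtain rfl := (functionSpace X sierpinski).unique hq hq'
    exact Subtype.ext (Set.ext fun x => (hχ x).symm.trans (hχ' x))
  surjective := by
    rintro ⟨U, χ, hχ⟩
    obtain ⟨q, hq⟩ := (functionSpace X sierpinski).surjective χ
    exact ⟨q, χ, hχ, hq⟩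

/-- The represented space `A(X)` of closed subsets of `X`: a name of `A` is a name of the open
set `X \ A` (negative information). -/
def closedSets (X : RepSpace) : RepSpace where
  carrier := {A : Set X.carrier // ∃ U : (openSets X).carrier, U.1 = Aᶜ}
  IsName q A := ∃ U : (openSets X).carrier, U.1 = A.1ᶜ ∧ (openSets X).IsName q U
  unique := by
    rintro q A B ⟨U, hU, hq⟩ ⟨V, hV, hq'⟩
    obtain rfl := (openSets X).unique hq hq'
    exact Subtype.ext (compl_injective (hU.symm.trans hV))
  surjective := by
    rintro ⟨A, U, hU⟩
    obtain ⟨q, hq⟩ := (openSets X).surjective U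
    exact ⟨q, U, hU, hq⟩

/-- Closed choice `C_X`: given a nonempty closed set, find one of its points. -/
def closedChoice (X : RepSpace) : MultiFun (closedSets X) X where
  dom := {A | A.1.Nonempty}
  val A := A.1
  nonempty _ h := h

/-! ### Trees and the perfect tree theorem -/

/-- The represented space of trees on `ℕ` (sets of words closed under prefixes), represented by
characteristic functions on the (coded) words. -/
def treeSpace : RepSpace where
  carrier := Descriptive.tree ℕ
  IsName p T := ∀ w : List ℕ,
    (w ∈ T → p (Encodable.encode w) = 1) ∧ (w ∉ T → p (Encodable.encode w) = 0)
  unique := by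
    intro p S T hS hT
    refine SetLike.ext fun w => ?_
    have h₁ := hS w
    have h₂ := hT w
    by_cases hs : w ∈ S <;> by_cases ht : w ∈ T <;> simp_all
  surjective T := by
    classical
    refine ⟨fun n => if Denumerable.ofNat (List ℕ) n ∈ T then 1 else 0, fun w => ?_⟩
    constructor <;> intro h <;> simp [h]

/-- The set `[T]` of infinite paths of `T`. -/
def body (T : Descriptive.tree ℕ) : Set Baire := {x | ∀ n, initSeg x n ∈ T}

/-- A perfect tree: a nonempty tree in which every node has two incomparable extensions. -/
def IsPerfectTree (T : Descriptive.tree ℕ) : Prop :=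
  (∃ v, v ∈ T) ∧ ∀ v ∈ T, ∃ u ∈ T, ∃ w ∈ T, v <+: u ∧ v <+: w ∧ ¬ u <+: w ∧ ¬ w <+: u

theorem initSeg_prefix (x : Baire) {m n : ℕ} (h : m ≤ n) : initSeg x m <+: initSeg x n := by
  obtain ⟨k, rfl⟩ := Nat.exists_eq_add_of_le h
  simp [initSeg, List.range_add]

theorem isClosed_body (T : Descriptive.tree ℕ) : IsClosed (body T) := by
  have h : body T = ⋂ n, {x | initSeg x n ∈ T} := by
    ext x
    simp [body]
  rw [h]
  refine isClosed_iInter fun n => ⟨?_⟩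
  rw [isOpen_iff_forall_mem_open]
  intro x hx
  refine ⟨PiNat.cylinder x n, fun y hy => ?_, PiNat.isOpen_cylinder _ _ _,
    PiNat.self_mem_cylinder _ _⟩
  have : initSeg y n = initSeg x n := (initSeg_eq_iff _ _ _).2 hy
  simpa [this] using hx

/-- The perfect tree theorem. -/
theorem exists_perfect_subtree (T : Descriptive.tree ℕ) (hT : ¬ (body T).Countable) :
    ∃ T' : Descriptive.tree ℕ, T' ≤ T ∧ IsPerfectTree T' := by
  obtain ⟨D, hD, ⟨x₀, hx₀⟩, hDT⟩ :=
    exists_perfect_nonempty_of_isClosed_of_not_countable (isClosed_body T) hT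
  refine ⟨⟨{v | ∃ x ∈ D, ∃ n, v = initSeg x n}, ?_⟩, ?_, ⟨[], x₀, hx₀, 0, rfl⟩, ?_⟩
  · rintro v a ⟨x, hx, n, hn⟩
    refine ⟨x, hx, v.length, ?_⟩
    have hlen : n = v.length + 1 := by
      have := congrArg List.length hn
      simp [initSeg_length] at this
      omega
    subst hlen
    have : v ++ [a] = initSeg x v.length ++ [x v.length] := by
      rw [hn]
      simp [initSeg, List.range_succ]
    exact (List.append_inj this (by rw [initSeg_length])).1
  · rintro v ⟨x, hx, n, rfl⟩
    exact hDT hx n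
  · rintro v ⟨x, hx, n, rfl⟩
    obtain ⟨y, ⟨hyc, hyD⟩, hyx⟩ := preperfect_iff_nhds.1 hD.acc x hx (PiNat.cylinder x n)
      ((PiNat.isOpen_cylinder _ _ _).mem_nhds (PiNat.self_mem_cylinder _ _))
    obtain ⟨i, hi⟩ := Function.ne_iff.1 hyx
    have hxy : initSeg x n = initSeg y n := ((initSeg_eq_iff _ _ _).2 hyc).symm
    set m := max n (i + 1) with hm
    have hne : initSeg x m ≠ initSeg y m := fun h =>
      hi ((initSeg_eq_iff _ _ _).1 h i (by omega)).symm
    refine ⟨initSeg x m, ⟨x, hx, m, rfl⟩, initSeg y m, ⟨y, hyD, m, rfl⟩,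
      initSeg_prefix x (le_max_left _ _), ?_, ?_, ?_⟩
    · rw [hxy]
      exact initSeg_prefix y (le_max_left _ _)
    · exact fun h => hne (h.eq_of_length (by simp [initSeg_length]))
    · exact fun h => hne (h.eq_of_length (by simp [initSeg_length])).symm

/-- The one-sided perfect tree theorem `PTT₁`: given a tree with uncountably many paths, find a
perfect subtree. -/
def PTT₁ : MultiFun treeSpace treeSpace where
  dom := {T : Descriptive.tree ℕ | ¬ (body T).Countable}
  val T := {T' : Descriptive.tree ℕ | T' ≤ (show Descriptive.tree ℕ from T) ∧ IsPerfectTree T'}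
  nonempty T hT := exists_perfect_subtree T hT

end Weihrauch

namespace Weihrauch

open Encodable Denumerable

/-! ### Words and computable functions on Baire space -/

/-! Being a perfect subtree of `T` is not by itself a closed condition, because each node must have
a splitting somewhere above it. It becomes closed once the splittings are part of the data: a point
of Baire space can record which words are nodes and, for each node, two incomparable extensions that
are nodes too. Every requirement then involves finitely many entries, so a name of the closed set of
such records is computable from `T` (`exists_computable_name`). The classical perfect tree theorem
makes this set nonempty, and forgetting the splittings in a chosen record leaves a perfect subtree.

Conversely, from a name of a nonempty closed set `A` one computes a tree whose paths, read as
sequences of pairs, are exactly those with first component in `A` (`mem_body_unrefutedTree`). The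
free second component makes the body uncountable. This tree may have dead ends, but a perfect
subtree has none, so a greedy search through it always makes progress (`exists_le_length_climb`).
The first components of the resulting path form a point of `A`. -/

theorem initSeg_getD (p : Baire) {n k : ℕ} (h : k < n) : (initSeg p n).getD k 0 = p k := by
  simp [initSeg, List.getD, h]

theorem initSeg_map (f : ℕ → ℕ) (p : Baire) (n : ℕ) :
    (initSeg p n).map f = initSeg (fun k => f (p k)) n := by
  simp [initSeg, Function.comp_def]

theorem map_range_length_initSeg (g : ℕ → List ℕ → ℕ) (p y : Baire) (m n : ℕ)
    (h : ∀ j < m, g j (initSeg p n) = y j) :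
    (List.range m).map (fun j => g j (initSeg p n)) = initSeg y m := by
  simpa [initSeg] using h

/-- A chain of words of unbounded length determines a sequence. -/
theorem exists_limit_of_chain (l : ℕ → List ℕ) (hmono : ∀ n, l n <+: l (n + 1))
    (hlen : ∀ k, ∃ n, k ≤ (l n).length) : ∃ y : Baire, ∀ n, l n = initSeg y (l n).length := by
  have hle : ∀ m n, m ≤ n → l m <+: l n := fun m n h =>
    Nat.le_induction (List.prefix_refl _) (fun n _ ih => ih.trans (hmono n)) n h
  choose N hN using hlen
  refine ⟨fun k => (l (N (k + 1))).getD k 0, fun n => List.ext_getElem (by simp [initSeg]) ?_⟩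
  intro i hi _
  have hi' : i < (l (N (i + 1))).length := hN (i + 1)
  have key : (l n)[i]? = (l (N (i + 1)))[i]? := by
    rcases le_total n (N (i + 1)) with h | h
    · obtain ⟨t, ht⟩ := hle _ _ h
      rw [← ht, List.getElem?_append_left hi]
    · obtain ⟨t, ht⟩ := hle _ _ h
      rw [← ht, List.getElem?_append_left hi']
  simp [initSeg, List.getD, ← key, hi]

theorem primrecRel_isPrefix : PrimrecRel fun u v : List ℕ => u <+: v :=
  (Primrec.eq.comp Primrec.fst
    (Primrec.list_take.comp (Primrec.list_length.comp Primrec.fst) Primrec.snd)).of_eq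
    fun _ => List.prefix_iff_eq_take.symm

/-- A total function whose `j`-th value can be read off primitive recursively from every
initial segment of the input of length at least `2 * j + 2` is computable. -/
theorem isComputable_of_entries (F : Baire → Baire) (g : ℕ → List ℕ → ℕ) (hg : Primrec₂ g)
    (h : ∀ p j n, 2 * j + 2 ≤ n → g j (initSeg p n) = F p j) :
    IsComputable (F : Baire →. Baire) := by
  -- In `pair p s` the entry `s j` sits at position `2 * j + 1`; halving the length ensures that
  -- this position has been read for every `j` that is output.
  refine ⟨fun σ => (List.range (σ.length / 2)).map fun j => g j σ, ?_, ?_⟩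
  · refine (Primrec.list_map ?_ ?_).to_comp
    · exact Primrec.list_range.comp
        (Primrec.nat_div.comp Primrec.list_length (Primrec.const 2))
    · exact hg.comp Primrec.snd Primrec.fst
  · rintro p y hy
    obtain rfl : F p = y := by simpa [eq_comm] using hy
    refine mem_limitFun.2 ⟨fun n => ?_, fun k => ⟨2 * k, ?_⟩⟩
    · simp only [List.length_map, List.length_range, initSeg_length]
      exact map_range_length_initSeg g p _ _ _ fun j hj => h p j n (by omega)
    · simp [initSeg_length]

/-- An output entry is already fixed by a finite initial segment of the input, hence is constant on
a cylinder within the domain. -/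
theorem isContinuous_limitFun (φ : List ℕ → List ℕ) : IsContinuous (limitFun φ) := by
  refine continuous_pi fun i => continuous_iff_continuousAt.2 fun p => ?_
  have hp : Produces φ p.1 ((limitFun φ).fn p.1 p.2) := mem_limitFun.1 ⟨p.2, rfl⟩
  obtain ⟨n, hn⟩ := hp.2 (i + 1)
  refine ContinuousAt.congr (f := fun _ => (limitFun φ).fn p.1 p.2 i) continuousAt_const ?_
  have hU : Subtype.val ⁻¹' PiNat.cylinder p.1 n ∈ nhds p :=
    continuous_subtype_val.continuousAt.preimage_mem_nhds
      ((PiNat.isOpen_cylinder (fun _ => ℕ) _ n).mem_nhds (PiNat.self_mem_cylinder _ _))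
  filter_upwards [hU] with p' hp'
  have hp'' : Produces φ p'.1 ((limitFun φ).fn p'.1 p'.2) := mem_limitFun.1 ⟨p'.2, rfl⟩
  have e : initSeg p'.1 n = initSeg p.1 n := (initSeg_eq_iff _ _ _).2 hp'
  have h₁ := hp.1 n
  have h₂ := hp''.1 n
  rw [e] at h₂
  exact (initSeg_eq_iff _ _ _).1 (h₁.symm.trans h₂) i hn

/-! ### Names of closed subsets of Baire space -/

/-- The word function coded by `q` does double duty: its limit function is a continuous realizer, so
`A` belongs to the space of closed sets, and `q` itself is a name of `A`. -/
theorem exists_isName_closedSets (q : Baire) (A : Set Baire)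
    (h : ∀ x, ∃ r, Produces (wordFun q) x r ∧ ((∃ n, r n ≠ 0) ↔ x ∉ A)) :
    ∃ B : (closedSets baireSpace).carrier, B.1 = A ∧ (closedSets baireSpace).IsName q B := by
  have hr : Realizes (X := baireSpace) (Y := sierpinski) (limitFun (wordFun q))
      (MultiFun.ofFun fun x : Baire => x ∉ A) := by
    rintro p _ rfl -
    obtain ⟨r, hr, hn⟩ := h p
    exact ⟨r, mem_limitFun.2 hr, p ∉ A, rfl, hn.symm⟩
  let χ : (functionSpace baireSpace sierpinski).carrier :=
    ⟨fun x : Baire => x ∉ A, _, isContinuous_limitFun _, hr⟩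
  let U : (openSets baireSpace).carrier := ⟨Aᶜ, χ, fun _ => Iff.rfl⟩
  exact ⟨⟨A, U, rfl⟩, rfl, U, rfl, χ, fun _ => Iff.rfl, hr⟩

theorem produces_of_isName_closedSets {q : Baire} {A : (closedSets baireSpace).carrier}
    (h : (closedSets baireSpace).IsName q A) (x : Baire) :
    ∃ r, Produces (wordFun q) x r ∧ ((∃ n, r n ≠ 0) ↔ x ∉ (A.1 : Set Baire)) := by
  obtain ⟨U, hU, χ, hχ, hq⟩ := h
  obtain ⟨r, hr, y, hy, hry⟩ := hq x x rfl trivial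
  refine ⟨r, mem_limitFun.1 hr, hry.symm.trans ?_⟩
  have hy' : y = χ.1 x := hy
  rw [hy', hχ x, hU]
  rfl

/-- A closed set defined by primitive recursive conditions on initial segments of its points and
of a parameter has a name that is computable from the parameter. -/
theorem exists_computable_name (C : ℕ → Baire → Baire → Prop)
    (hloc : ∀ i x x' p p', (∀ k < i, x k = x' k) → (∀ k < i, p k = p' k) → C i x p → C i x' p')
    (hC : PrimrecPred fun t : ℕ × List ℕ × List ℕ =>
      C t.1 (fun k => t.2.1.getD k 0) (fun k => t.2.2.getD k 0)) :
    ∃ H : Baire → Baire, IsComputable (H : Baire →. Baire) ∧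
      ∀ p, ∃ B : (closedSets baireSpace).carrier, B.1 = {x : Baire | ∀ i, C i x p} ∧
        (closedSets baireSpace).IsName (H p) B := by
  classical
  -- A nonzero output entry reports a violated condition. Padding `w` with zeros is harmless, since
  -- condition `i` depends only on entries below `i`, and `i < w.length`.
  let φ : Baire → List ℕ → List ℕ := fun p w =>
    (List.range w.length).map fun i => if C i (fun k => w.getD k 0) p then 0 else 1
  refine ⟨fun p j => encode (φ p (ofNat (List ℕ) j)),
    isComputable_of_entries _
      (fun j σ => encode (φ (fun k => σ.getD k 0) (ofNat (List ℕ) j))) ?_ ?_, fun p => ?_⟩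
  · refine Primrec.encode.comp (Primrec.list_map ?_ ?_)
    · exact Primrec.list_range.comp
        (Primrec.list_length.comp ((Primrec.ofNat (List ℕ)).comp Primrec.fst))
    · refine Primrec.ite (hC.comp (Primrec.pair Primrec.snd (Primrec.pair
        ((Primrec.ofNat (List ℕ)).comp (Primrec.fst.comp Primrec.fst))
        (Primrec.snd.comp Primrec.fst)))) (Primrec.const 0) (Primrec.const 1)
  · intro p j n hn
    -- A word is no longer than its code, so entry `j` of the name depends only on entries of `p`
    -- below `j`.
    have hj : (ofNat (List ℕ) j).length ≤ j := by
      simpa using length_le_encode (ofNat (List ℕ) j)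
    refine congrArg encode (List.map_congr_left fun i hi => ?_)
    have hi' : i < (ofNat (List ℕ) j).length := List.mem_range.1 hi
    refine if_congr ⟨hloc _ _ _ _ _ (fun _ _ => rfl) fun k hk => initSeg_getD _ (by omega),
      hloc _ _ _ _ _ (fun _ _ => rfl) fun k hk => (initSeg_getD _ (by omega)).symm⟩ rfl rfl
  · refine exists_isName_closedSets _ _ fun x => ⟨fun i => if C i x p then 0 else 1, ?_, by simp⟩
    have hw : wordFun (fun j => encode (φ p (ofNat (List ℕ) j))) = φ p := by
      funext w
      simp [wordFun]
    rw [hw]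
    refine ⟨fun n => ?_, fun k => ⟨k, by simp [φ, initSeg_length]⟩⟩
    simp only [φ, List.length_map, List.length_range, initSeg_length]
    refine map_range_length_initSeg
      (fun i w => if C i (fun k => w.getD k 0) p then 0 else 1) x _ n n fun i hi => ?_
    exact if_congr ⟨hloc _ _ _ _ _ (fun k hk => initSeg_getD _ (by omega)) fun _ _ => rfl,
      hloc _ _ _ _ _ (fun k hk => (initSeg_getD _ (by omega)).symm) fun _ _ => rfl⟩ rfl rfl

/-! ### From the perfect tree theorem to closed choice -/

/-- `u` and `w` are incomparable extensions of `v`. -/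
def Splits (v u w : List ℕ) : Prop := v <+: u ∧ v <+: w ∧ ¬ u <+: w ∧ ¬ w <+: u

/-- The sequence `x` satisfies, as far as its first `i` entries tell, the condition that the codes
`k` with `x k ≠ 0` are those of the nodes of a perfect subtree of the tree with the characteristic
function `p`, where `x k - 1` codes two incomparable extensions of the node coded by `k`. -/
def CodesPerfectSubtree (i : ℕ) (x p : Baire) : Prop :=
  (0 < i → x 0 ≠ 0) ∧ ∀ k < i, x k ≠ 0 →
    p k ≠ 0 ∧ (∀ l < i, ofNat (List ℕ) l <+: ofNat (List ℕ) k → x l ≠ 0) ∧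
      Splits (ofNat (List ℕ) k) (ofNat (List ℕ) (x k - 1).unpair.1)
        (ofNat (List ℕ) (x k - 1).unpair.2) ∧
      ((x k - 1).unpair.1 < i → x (x k - 1).unpair.1 ≠ 0) ∧
      ((x k - 1).unpair.2 < i → x (x k - 1).unpair.2 ≠ 0)

/-- The bounds by `i` guard every lookup in `x` and `p`; this is the locality that
`exists_computable_name` requires. -/
theorem CodesPerfectSubtree.congr (i : ℕ) (x x' p p' : Baire) (hx : ∀ k < i, x k = x' k)
    (hp : ∀ k < i, p k = p' k) (h : CodesPerfectSubtree i x p) : CodesPerfectSubtree i x' p' := by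
  refine ⟨fun hi => hx 0 hi ▸ h.1 hi, fun k hk hk0 => ?_⟩
  rw [← hx k hk] at hk0 ⊢
  obtain ⟨h₁, h₂, h₃, h₄, h₅⟩ := h.2 k hk hk0
  exact ⟨hp k hk ▸ h₁, fun l hl hlk => hx l hl ▸ h₂ l hl hlk, h₃,
    fun hi => hx _ hi ▸ h₄ hi, fun hi => hx _ hi ▸ h₅ hi⟩

theorem primrecPred_splits {α : Type} [Primcodable α] {f g h : α → List ℕ} (hf : Primrec f)
    (hg : Primrec g) (hh : Primrec h) : PrimrecPred fun a => Splits (f a) (g a) (h a) :=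
  (primrecRel_isPrefix.comp hf hg).and ((primrecRel_isPrefix.comp hf hh).and
    ((primrecRel_isPrefix.comp hg hh).not.and (primrecRel_isPrefix.comp hh hg).not))

theorem PrimrecPred.imp {α : Type} [Primcodable α] {p q : α → Prop} (hp : PrimrecPred p)
    (hq : PrimrecPred q) : PrimrecPred fun a => p a → q a :=
  (hp.not.or hq).of_eq fun _ => imp_iff_not_or.symm

theorem PrimrecPred.forall_lt_comp {α : Type} [Primcodable α] {q : ℕ → α → Prop} {f : α → ℕ}
    (hf : Primrec f) (hq : PrimrecPred fun s : ℕ × α => q s.1 s.2) :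
    PrimrecPred fun a => ∀ k < f a, q k a := by
  have hR : PrimrecRel q := hq
  exact (hR.forall_mem_list.comp (Primrec.list_range.comp hf) Primrec.id).of_eq fun a => by simp

theorem primrecPred_codesPerfectSubtree : PrimrecPred fun t : ℕ × List ℕ × List ℕ =>
    CodesPerfectSubtree t.1 (fun k => t.2.1.getD k 0) (fun k => t.2.2.getD k 0) := by
  have entry : ∀ {α : Type} [Primcodable α] {w : α → List ℕ} {k : α → ℕ}, Primrec w → Primrec k →
      PrimrecPred fun a => (w a).getD (k a) 0 ≠ 0 := fun hw hk =>
    (Primrec.eq.comp ((Primrec.list_getD 0).comp hw hk) (Primrec.const 0)).not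
  refine PrimrecPred.and ?_ ?_
  · exact PrimrecPred.imp (Primrec.nat_lt.comp (Primrec.const 0) Primrec.fst)
      (entry (Primrec.fst.comp Primrec.snd) (Primrec.const 0))
  · refine PrimrecPred.forall_lt_comp Primrec.fst ?_
    have hk : Primrec fun s : ℕ × (ℕ × List ℕ × List ℕ) => s.1 := Primrec.fst
    have hi : Primrec fun s : ℕ × (ℕ × List ℕ × List ℕ) => s.2.1 :=
      Primrec.fst.comp Primrec.snd
    have hw : Primrec fun s : ℕ × (ℕ × List ℕ × List ℕ) => s.2.2.1 :=
      Primrec.fst.comp (Primrec.snd.comp Primrec.snd)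
    have hσ : Primrec fun s : ℕ × (ℕ × List ℕ × List ℕ) => s.2.2.2 :=
      Primrec.snd.comp (Primrec.snd.comp Primrec.snd)
    have hu : Primrec fun s : ℕ × (ℕ × List ℕ × List ℕ) => (s.2.2.1.getD s.1 0 - 1).unpair :=
      Primrec.unpair.comp
        (Primrec.nat_sub.comp ((Primrec.list_getD 0).comp hw hk) (Primrec.const 1))
    have hu₁ := Primrec.fst.comp hu
    have hu₂ := Primrec.snd.comp hu
    have hof := Primrec.ofNat (List ℕ)
    refine PrimrecPred.imp (entry hw hk) ((entry hσ hk).and (PrimrecPred.and ?_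
      ((primrecPred_splits (hof.comp hk) (hof.comp hu₁) (hof.comp hu₂)).and
        ((PrimrecPred.imp (Primrec.nat_lt.comp hu₁ hi) (entry hw hu₁)).and
          (PrimrecPred.imp (Primrec.nat_lt.comp hu₂ hi) (entry hw hu₂))))))
    refine PrimrecPred.forall_lt_comp hi ?_
    exact PrimrecPred.imp
      (primrecRel_isPrefix.comp (hof.comp Primrec.fst) (hof.comp (hk.comp Primrec.snd)))
      (entry (hw.comp Primrec.snd) Primrec.fst)

/-- The tree of the words with nonzero entries in `x`. -/
def codedTree (x p : Baire) (h : ∀ i, CodesPerfectSubtree i x p) : Descriptive.tree ℕ :=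
  ⟨{v | x (encode v) ≠ 0}, by
    intro v a (hv : x _ ≠ 0)
    -- Any stage beyond both codes activates the condition of closure under prefixes.
    have := (h (encode (v ++ [a]) + encode v + 1)).2 (encode (v ++ [a])) (by omega) hv
    exact this.2.1 (encode v) (by omega) (by simp)⟩

theorem isPerfectTree_codedTree (x p : Baire) (h : ∀ i, CodesPerfectSubtree i x p) :
    IsPerfectTree (codedTree x p h) := by
  -- The empty word has code `0`.
  refine ⟨⟨[], (h 1).1 one_pos⟩, fun v (hv : x _ ≠ 0) => ?_⟩
  obtain ⟨-, -, h₃, h₄, h₅⟩ :=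
    (h (encode v + (x (encode v) - 1).unpair.1 + (x (encode v) - 1).unpair.2 + 1)).2 (encode v) (by omega) hv
  rw [ofNat_encode] at h₃
  refine ⟨ofNat (List ℕ) (x (encode v) - 1).unpair.1, ?_, ofNat (List ℕ) (x (encode v) - 1).unpair.2, ?_, h₃⟩
  · change x (encode (ofNat (List ℕ) _)) ≠ 0
    rw [encode_ofNat]
    exact h₄ (by omega)
  · change x (encode (ofNat (List ℕ) _)) ≠ 0
    rw [encode_ofNat]
    exact h₅ (by omega)

theorem codedTree_le (x p : Baire) (h : ∀ i, CodesPerfectSubtree i x p) (T : Descriptive.tree ℕ)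
    (hp : treeSpace.IsName p T) : codedTree x p h ≤ T := by
  intro v (hv : x _ ≠ 0)
  by_contra hT
  exact ((h (encode v + 1)).2 (encode v) (by omega) hv).1 ((hp v).2 hT)

theorem exists_codesPerfectSubtree (T T' : Descriptive.tree ℕ) (hle : T' ≤ T)
    (hT' : IsPerfectTree T') (p : Baire) (hp : treeSpace.IsName p T) :
    ∃ x, ∀ i, CodesPerfectSubtree i x p := by
  classical
  have hsplit : ∀ v : List ℕ, ∃ u w, v ∈ T' → u ∈ T' ∧ w ∈ T' ∧ Splits v u w := fun v => by
    by_cases hv : v ∈ T'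
    · obtain ⟨u, hu, w, hw, h⟩ := hT'.2 v hv
      exact ⟨u, w, fun _ => ⟨hu, hw, h⟩⟩
    · exact ⟨[], [], fun h => absurd h hv⟩
  choose u w huw using hsplit
  -- The shift by one reserves the value `0` for words outside `T'`.
  let x : Baire := fun k =>
    if ofNat (List ℕ) k ∈ T' then
      Nat.pair (encode (u (ofNat (List ℕ) k))) (encode (w (ofNat (List ℕ) k))) + 1 else 0
  have hx0 : ∀ k, x k ≠ 0 ↔ ofNat (List ℕ) k ∈ T' := fun k => by simp [x]
  have hxe : ∀ v, v ∈ T' → x (encode v) ≠ 0 := fun v hv => (hx0 _).2 (by simpa using hv)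
  have hnil : [] ∈ T' := by
    obtain ⟨v, hv⟩ := hT'.1
    exact Descriptive.Tree.mem_of_prefix v.nil_prefix hv
  refine ⟨x, fun i => ⟨fun _ => hxe _ hnil, fun k hk hk0 => ?_⟩⟩
  have hkT := (hx0 k).1 hk0
  obtain ⟨hu, hw, hs⟩ := huw _ hkT
  have hxk : x k - 1 =
      Nat.pair (encode (u (ofNat (List ℕ) k))) (encode (w (ofNat (List ℕ) k))) := by
    simp [x, hkT]
  rw [hxk, Nat.unpair_pair]
  refine ⟨?_, fun l _ hlk => (hx0 l).2 (Descriptive.Tree.mem_of_prefix hlk hkT), ?_,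
    fun _ => hxe _ hu, fun _ => hxe _ hw⟩
  · have := (hp (ofNat (List ℕ) k)).1 (hle hkT)
    rw [encode_ofNat] at this
    omega
  · simpa using hs

theorem PTT₁_le_closedChoice : WeihrauchReducible PTT₁ (closedChoice baireSpace) := by
  obtain ⟨H, hH, hname⟩ := exists_computable_name CodesPerfectSubtree
    CodesPerfectSubtree.congr primrecPred_codesPerfectSubtree
  -- The odd entries of the pair are the chosen record; flattening its nonzero entries to `1` erases
  -- the splittings.
  refine ⟨fun r => Part.some fun k => if r (2 * k + 1) = 0 then 0 else 1, H, ?_, hH, ?_⟩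
  · refine isComputable_of_entries _
      (fun k σ => if σ.getD (2 * k + 1) 0 = 0 then 0 else 1) ?_ fun p j n hn => ?_
    · refine Primrec.ite (Primrec.eq.comp ((Primrec.list_getD 0).comp Primrec.snd
        (Primrec.succ.comp (Primrec.nat_mul.comp (Primrec.const 2) Primrec.fst)))
        (Primrec.const 0)) (Primrec.const 0) (Primrec.const 1)
    · rw [initSeg_getD _ (by omega)]
  · intro G hG p T hp hT
    obtain ⟨B, hB, hBn⟩ := hname p
    obtain ⟨T', hle, hT'⟩ := exists_perfect_subtree T hT
    obtain ⟨x, hx⟩ := exists_codesPerfectSubtree T T' hle hT' p hp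
    have hdom : B ∈ (closedChoice baireSpace).dom := ⟨x, hB ▸ hx⟩
    obtain ⟨s, hs, y, hy, rfl⟩ := hG (H p) B hBn hdom
    have hsC : ∀ i, CodesPerfectSubtree i s p := by
      have : s ∈ (B.1 : Set Baire) := hy
      rwa [hB] at this
    refine ⟨_, Part.mem_bind (Part.mem_some _) (Part.mem_bind hs (Part.mem_some _)),
      codedTree s p hsC, ⟨codedTree_le s p hsC T hp, isPerfectTree_codedTree s p hsC⟩,
      fun v => ?_⟩
    have hodd : pair p s (2 * encode v + 1) = s (encode v) := by
      have h₁ : (2 * encode v + 1) % 2 ≠ 0 := by omega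
      have h₂ : (2 * encode v + 1) / 2 = encode v := by omega
      simp only [pair, if_neg h₁, h₂]
    simp only [hodd]
    exact ⟨fun hv : s _ ≠ 0 => if_neg hv, fun hv : ¬ s _ ≠ 0 => if_pos (not_not.1 hv)⟩

/-! ### From closed choice to the perfect tree theorem -/

/-- The word of the first components of the entries of `w`. -/
def fsts (w : List ℕ) : List ℕ := w.map fun n => n.unpair.1

theorem fsts_initSeg (z : Baire) (n : ℕ) :
    fsts (initSeg z n) = initSeg (fun k => (z k).unpair.1) n :=
  initSeg_map _ z n

theorem primrec_fsts : Primrec fsts :=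
  Primrec.list_map Primrec.id (Primrec.fst.comp (Primrec.unpair.comp Primrec.snd))

/-- The word function coded by `q` has only zeros in its values at those initial segments of the
first components of `w` that have a code less than the length of `w`. -/
def Unrefuted (q : Baire) (w : List ℕ) : Prop :=
  ∀ k < w.length, ofNat (List ℕ) k <+: fsts w → ∀ a ∈ ofNat (List ℕ) (q k), a = 0

theorem primrecPred_unrefuted : PrimrecPred fun t : List ℕ × List ℕ =>
    Unrefuted (fun k => t.1.getD k 0) t.2 := by
  refine PrimrecPred.forall_lt_comp (Primrec.list_length.comp Primrec.snd) ?_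
  have hof := Primrec.ofNat (List ℕ)
  refine PrimrecPred.imp (primrecRel_isPrefix.comp (hof.comp Primrec.fst)
    (primrec_fsts.comp (Primrec.snd.comp Primrec.snd))) ?_
  have h0 : PrimrecPred fun a : ℕ => a = 0 := Primrec.eq.comp Primrec.id (Primrec.const 0)
  exact h0.forall_mem_list.comp (hof.comp
    ((Primrec.list_getD 0).comp (Primrec.fst.comp Primrec.snd) Primrec.fst))

theorem Unrefuted.congr {q q' : Baire} {w : List ℕ} (h : ∀ k < w.length, q k = q' k)
    (hw : Unrefuted q w) : Unrefuted q' w := fun k hk => h k hk ▸ hw k hk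

/-- The tree of the words that are not refuted by `q`. -/
def unrefutedTree (q : Baire) : Descriptive.tree ℕ :=
  ⟨{w | Unrefuted q w}, by
    intro w a hw k hk hkw
    exact hw k (by simp; omega) (hkw.trans (by simp [fsts]))⟩

/-- Along a path every initial segment of the first components is eventually tested, so any
refutation in the limit is found. If the limit is in `A`, all the outputs tested are initial
segments of the zero sequence. -/
theorem mem_body_unrefutedTree {q : Baire} {A : (closedSets baireSpace).carrier}
    (h : (closedSets baireSpace).IsName q A) (z : Baire) :
    z ∈ body (unrefutedTree q) ↔ (fun k => (z k).unpair.1) ∈ (A.1 : Set Baire) := by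
  set x : Baire := fun k => (z k).unpair.1 with hx
  obtain ⟨r, hr, hrA⟩ := produces_of_isName_closedSets h x
  constructor
  · intro hz
    by_contra hxA
    obtain ⟨n, hn⟩ := hrA.2 hxA
    obtain ⟨m, hm⟩ := hr.2 (n + 1)
    set k := encode (initSeg x m) with hk
    -- This length lets the node contain the first `m` entries of `x` and exceed the code `k` under
    -- test.
    refine hn (hz (max m (k + 1)) k (by simp [initSeg_length]) ?_ _ ?_)
    · rw [fsts_initSeg, hk, ofNat_encode]
      exact initSeg_prefix x (le_max_left _ _)
    · have hφ : ofNat (List ℕ) (q k) = _ := hr.1 m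
      rw [hφ]
      exact List.mem_map.2 ⟨n, List.mem_range.2 hm, rfl⟩
  · intro hxA n k _ hkn a ha
    rw [fsts_initSeg] at hkn
    have hle : (ofNat (List ℕ) k).length ≤ n := by simpa [initSeg_length] using hkn.length_le
    have hseg : ofNat (List ℕ) k = initSeg x (ofNat (List ℕ) k).length :=
      (List.prefix_of_prefix_length_le hkn (initSeg_prefix x hle)
        (by simp [initSeg_length])).eq_of_length (by simp [initSeg_length])
    have hφ := hr.1 (ofNat (List ℕ) k).length
    rw [← hseg] at hφ
    have hq : wordFun q (ofNat (List ℕ) k) = ofNat (List ℕ) (q k) := by simp [wordFun]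
    rw [hq] at hφ
    rw [hφ] at ha
    obtain ⟨i, -, rfl⟩ := List.mem_map.1 ha
    by_contra hi
    exact hrA.1 ⟨i, hi⟩ hxA

/-- Pairing a fixed `a` in `A` with arbitrary second components injects Baire space into the body.
-/
theorem not_countable_body_unrefutedTree {q : Baire} {A : (closedSets baireSpace).carrier}
    (h : (closedSets baireSpace).IsName q A) (hA : (A.1 : Set Baire).Nonempty) :
    ¬ (body (unrefutedTree q)).Countable := by
  obtain ⟨a, ha⟩ := hA
  intro hc
  let f : Baire → Baire := fun b n => Nat.pair (a n) (b n)
  have hf : Function.Injective f := fun b b' hbb => funext fun n =>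
    (Nat.pair_eq_pair.1 (congrFun hbb n)).2
  have hpre : f ⁻¹' body (unrefutedTree q) = Set.univ := by
    refine Set.eq_univ_of_forall fun b => (mem_body_unrefutedTree h _).2 ?_
    have hfst : (fun n => (f b n).unpair.1) = a := by simp [f]
    rw [hfst]
    exact ha
  have hu := hc.preimage hf
  rw [hpre, Set.countable_univ_iff, ← Cardinal.mk_le_aleph0_iff] at hu
  have : Cardinal.mk Baire = Cardinal.continuum := by simp [Baire]
  exact absurd hu (by rw [this]; exact not_le.2 Cardinal.aleph0_lt_continuum)

/-- The node reached after `n` steps when, going through the codes of all words in order, one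
moves to each word marked by `s` that extends the current node. -/
def climb (s : Baire) : ℕ → List ℕ
  | 0 => []
  | n + 1 => if s n = 1 ∧ climb s n <+: ofNat (List ℕ) n then ofNat (List ℕ) n else climb s n

theorem climb_congr {s s' : Baire} {n : ℕ} (h : ∀ k < n, s k = s' k) :
    climb s n = climb s' n := by
  induction n with
  | zero => rfl
  | succ n ih => simp only [climb, h n n.lt_succ_self, ih fun k hk => h k (by omega)]

theorem climb_prefix (s : Baire) (n : ℕ) : climb s n <+: climb s (n + 1) := by
  rw [climb]
  split_ifs with h
  · exact h.2
  · exact List.prefix_refl _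

theorem climb_prefix_of_le (s : Baire) {m n : ℕ} (h : m ≤ n) : climb s m <+: climb s n :=
  Nat.le_induction (List.prefix_refl _) (fun _ _ ih => ih.trans (climb_prefix s _)) n h

theorem primrec_climb : Primrec₂ fun (σ : List ℕ) n => climb (fun k => σ.getD (2 * k + 1) 0) n := by
  have hof := Primrec.ofNat (List ℕ)
  have hσ : Primrec fun t : List ℕ × (ℕ × List ℕ) => t.1 := Primrec.fst
  have hn : Primrec fun t : List ℕ × (ℕ × List ℕ) => t.2.1 := Primrec.fst.comp Primrec.snd
  have hv : Primrec fun t : List ℕ × (ℕ × List ℕ) => t.2.2 := Primrec.snd.comp Primrec.snd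
  have hstep : Primrec₂ fun (σ : List ℕ) (t : ℕ × List ℕ) =>
      if σ.getD (2 * t.1 + 1) 0 = 1 ∧ t.2 <+: ofNat (List ℕ) t.1 then ofNat (List ℕ) t.1
        else t.2 :=
    Primrec.ite ((Primrec.eq.comp ((Primrec.list_getD 0).comp hσ
      (Primrec.succ.comp (Primrec.nat_mul.comp (Primrec.const 2) hn))) (Primrec.const 1)).and
      (primrecRel_isPrefix.comp hv (hof.comp hn))) (hof.comp hn) hv
  refine (Primrec.nat_rec (Primrec.const []) hstep).of_eq fun σ n => ?_
  induction n with
  | zero => rfl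
  | succ n ih =>
    simp only at ih
    simp only [climb, ih]

theorem climb_mem {T : Descriptive.tree ℕ} {s : Baire} (hs : treeSpace.IsName s T)
    (hT : [] ∈ T) (n : ℕ) : climb s n ∈ T := by
  induction n with
  | zero => exact hT
  | succ n ih =>
    rw [climb]
    split_ifs with h
    · by_contra hn
      have := (hs _).2 hn
      rw [encode_ofNat] at this
      omega
    · exact ih

theorem IsPerfectTree.nil_mem {T : Descriptive.tree ℕ} (hT : IsPerfectTree T) : [] ∈ T := by
  obtain ⟨v, hv⟩ := hT.1
  exact Descriptive.Tree.mem_of_prefix v.nil_prefix hv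

/-- Neither of two incomparable extensions of a node can equal the node, so each is strictly longer;
iterate. -/
theorem IsPerfectTree.exists_extension {T : Descriptive.tree ℕ} (hT : IsPerfectTree T)
    {v : List ℕ} (hv : v ∈ T) (k : ℕ) : ∃ w ∈ T, v <+: w ∧ v.length + k ≤ w.length := by
  induction k with
  | zero => exact ⟨v, hv, List.prefix_refl _, le_rfl⟩
  | succ k ih =>
    obtain ⟨w, hw, hvw, hk⟩ := ih
    obtain ⟨a, ha, b, hb, hwa, hwb, hab, -⟩ := hT.2 w hw
    have hlt : w.length < a.length := by
      by_contra hle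
      exact hab (hwa.eq_of_length (le_antisymm hwa.length_le (not_lt.1 hle)) ▸ hwb)
    exact ⟨a, ha, hvw.trans hwa, by omega⟩

theorem exists_le_length_climb {T : Descriptive.tree ℕ} {s : Baire} (hs : treeSpace.IsName s T)
    (hT : IsPerfectTree T) (k : ℕ) : ∃ n, k ≤ (climb s n).length := by
  induction k with
  | zero => exact ⟨0, Nat.zero_le _⟩
  | succ k ih =>
    obtain ⟨n, hn⟩ := ih
    -- The surplus `n + k + 1` makes `w` long enough for the goal and forces its code above `n`, so
    -- the search has not yet passed `w`.
    obtain ⟨w, hw, hvw, hlen⟩ := hT.exists_extension (climb_mem hs hT.nil_mem n) (n + k + 1)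
    have hcode := length_le_encode w
    -- either the climb has left the word `climb s n` before it meets `w`, or it moves to `w`
    by_cases hmove : climb s (encode w) = climb s n
    · refine ⟨encode w + 1, ?_⟩
      rw [climb, if_pos ⟨(hs w).1 hw, by rwa [hmove, ofNat_encode]⟩, ofNat_encode]
      omega
    · refine ⟨encode w, ?_⟩
      have hp := climb_prefix_of_le s (show n ≤ encode w by omega)
      have hl := hp.length_le
      by_contra hlt
      exact hmove (hp.eq_of_length (by omega)).symm

theorem closedChoice_le_PTT₁ : WeihrauchReducible (closedChoice baireSpace) PTT₁ := by
  classical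
  let H : Baire → Baire := fun q j => if Unrefuted q (ofNat (List ℕ) j) then 1 else 0
  -- Half of `σ` comes from the perfect tree, at the odd positions; this is exactly what `σ.length /
  -- 2` steps of the climb consult.
  let φ : List ℕ → List ℕ := fun σ =>
    fsts (climb (fun k => σ.getD (2 * k + 1) 0) (σ.length / 2))
  have hφ : Primrec φ := primrec_fsts.comp (primrec_climb.comp Primrec.id
    (Primrec.nat_div.comp Primrec.list_length (Primrec.const 2)))
  refine ⟨limitFun φ, H, ⟨φ, hφ.to_comp, fun p y hy => hy⟩, ?_, ?_⟩
  · refine isComputable_of_entries H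
      (fun j σ => if Unrefuted (fun k => σ.getD k 0) (ofNat (List ℕ) j) then 1 else 0) ?_
      fun q j n hn => ?_
    · exact Primrec.ite (primrecPred_unrefuted.comp
        (Primrec.pair Primrec.snd ((Primrec.ofNat (List ℕ)).comp Primrec.fst)))
        (Primrec.const 1) (Primrec.const 0)
    · have hj : (ofNat (List ℕ) j).length ≤ j := by
        simpa using length_le_encode (ofNat (List ℕ) j)
      exact if_congr ⟨Unrefuted.congr fun k hk => initSeg_getD _ (by omega),
        Unrefuted.congr fun k hk => (initSeg_getD _ (by omega)).symm⟩ rfl rfl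
  · intro G hG q A hq hA
    have hname : treeSpace.IsName (H q) (unrefutedTree q) := fun w => by
      have hw : H q (encode w) = if Unrefuted q w then 1 else 0 := by simp [H]
      rw [hw]
      exact ⟨fun h : Unrefuted q w => if_pos h, fun h : ¬ Unrefuted q w => if_neg h⟩
    obtain ⟨s, hs, T, ⟨hle, hT⟩, hsT⟩ :=
      hG (H q) (unrefutedTree q) hname (not_countable_body_unrefutedTree hq hA)
    have hlen := exists_le_length_climb hsT hT
    obtain ⟨z, hz⟩ := exists_limit_of_chain (climb s) (climb_prefix s) hlen
    have hbody : z ∈ body (unrefutedTree q) := fun n => by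
      obtain ⟨m, hm⟩ := hlen n
      refine hle (Descriptive.Tree.mem_of_prefix (initSeg_prefix z hm) ?_)
      rw [← hz m]
      exact climb_mem hsT hT.nil_mem m
    have hword : ∀ n, φ (initSeg (pair q s) n) = fsts (climb s (n / 2)) := fun n => by
      simp only [φ, initSeg_length]
      refine congrArg fsts (climb_congr fun k hk => ?_)
      rw [initSeg_getD _ (by omega)]
      have h₁ : (2 * k + 1) % 2 ≠ 0 := by omega
      have h₂ : (2 * k + 1) / 2 = k := by omega
      simp only [pair, if_neg h₁, h₂]
    refine ⟨fun k => (z k).unpair.1, Part.mem_bind (Part.mem_some _)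
      (Part.mem_bind hs (mem_limitFun.2 ⟨fun n => ?_, fun k => ?_⟩)), _,
      (mem_body_unrefutedTree hq z).1 hbody, rfl⟩
    · rw [hword, hz (n / 2), fsts_initSeg, initSeg_length]
    · obtain ⟨n, hn⟩ := hlen k
      refine ⟨2 * n, ?_⟩
      rw [hword, Nat.mul_div_cancel_left n two_pos]
      simpa [fsts] using hn

end Weihrauch

theorem proposition6p3 :
    Weihrauch.WeihrauchEquivalent Weihrauch.PTT₁
      (Weihrauch.closedChoice Weihrauch.baireSpace) :=
  ⟨Weihrauch.PTT₁_le_closedChoice, Weihrauch.closedChoice_le_PTT₁⟩
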